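/- Let $\mathbb K$ be $\mathbb R$ or $\mathbb C$; all Banach spaces are over $\mathbb K$ and operators are bounded and linear. For operators $S:W\to Z$ and $T:X\to Y$ between Banach spaces, $S$ *factors through* $T$ if there are operators $U:W\to X$ and $V:Y\to Z$ with $VTU=S$; an operator is *universal* for a class $\mathscr C$ of operators between Banach spaces if it belongs to $\mathscr C$ and factors through every member of $\mathscr C$. Let $\{0,1\}^\omega$ carry the product topology and let $C(\{0,1\}^\omega)$ be the Banach space of $\mathbb K$-valued continuous functions on it with the supremum norm. Let $(t_m)_{m\ge 1}$ enumerate the finite $0$-$1$ sequences by length and, within each length, lexicographically, so that $\{0,1\}^n=\{t_m\mid 2^n\le m<2^{n+1}\}$ for every $n\ge 0$. For a finite $0$-$1$ sequence $t$ let $\Delta_t\subseteq\{0,1\}^\omega$ be the set of infinite sequences with initial segment $t$ and $\chi_{\Delta_t}$ its indicator function. The Haar system is $h_0=\chi_{\{0,1\}^\omega}$ and $h_m=\chi_{\Delta_{t_m{}^\smallfrown 0}}-\chi_{\Delta_{t_m{}^\smallfrown 1}}$ for $m\ge 1$. Let $(e_m)_{m\ge1}$ be the standard unit vector basis of $\ell_1$.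 There is a unique operator $J:\ell_1\to C(\{0,1\}^\omega)$ with $Je_m=h_{m-1}$ for all $m\ge1$. If $X$ and $Y$ are Banach spaces with $Y$ separable, and $T:X\to Y$ is an operator whose adjoint $T^*:Y^*\to X^*$ has non-separable range $T^*(Y^*)$ in the norm topology, then $J$ factors through $T$. Moreover, $J$ is universal for the class of operators with separable codomain and adjoint of non-separable range; that is, $J$ also belongs to this class. -/

import Mathlib

open TopologicalSpace

universe u v w w₂ w₃

/-! ### The Haar system on the Cantor space

`{0,1}^ω` is `ℕ → Bool` with the product topology (`false` is `0`, `true` is `1`), and the set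
`𝒟` of finite sequences in `{0,1}` is `List Bool`. -/

/-- The enumeration `(t_m)_{m ≥ 1}` of the finite `0`-`1` sequences, by length and then
lexicographically: `t_m` is the binary expansion of `m`, most significant digit first, without its
leading `1`. (The value at `m = 0` is not used.) -/
def dyadicNode (m : ℕ) : List Bool := (Nat.bits m).reverse.tail

theorem dyadicNode_one : dyadicNode 1 = [] := by
  simp [dyadicNode]

theorem dyadicNode_bit (b : Bool) {m : ℕ} (hm : m ≠ 0) :
    dyadicNode (Nat.bit b m) = dyadicNode m ++ [b] := by
  have h : (Nat.bits m).reverse ≠ [] := by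
    intro h
    have h1 : Nat.bits m = [] := by simpa using h
    have h2 := Nat.size_eq_bits_len m
    rw [h1] at h2
    exact hm (Nat.size_eq_zero.1 h2.symm)
  unfold dyadicNode
  rw [Nat.bits_append_bit m b (fun h0 => absurd h0 hm), List.reverse_cons,
    List.tail_append_of_ne_nil h]

/-- The first property that determines the enumeration:
`{0,1}^n = {t_m | 2^n ≤ m < 2^(n+1)}`. -/
theorem image_dyadicNode (n : ℕ) :
    dyadicNode '' {m | 2 ^ n ≤ m ∧ m < 2 ^ (n + 1)} = {t | t.length = n} := by
  induction n with
  | zero =>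
    ext t
    simp only [Set.mem_image, Set.mem_ofPred_eq, List.length_eq_zero_iff]
    constructor
    · rintro ⟨m, ⟨h1, h2⟩, rfl⟩
      obtain rfl : m = 1 := by simp at h1 h2; omega
      exact dyadicNode_one
    · rintro rfl
      exact ⟨1, by norm_num, dyadicNode_one⟩
  | succ n ih =>
    ext t
    constructor
    · rintro ⟨m, ⟨h1, h2⟩, rfl⟩
      obtain ⟨b, k, rfl⟩ : ∃ b k, m = Nat.bit b k := ⟨_, _, (Nat.bit_bodd_div2 m).symm⟩
      have hk : 2 ^ n ≤ k ∧ k < 2 ^ (n + 1) := by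
        cases b <;> simp only [Nat.bit_false_apply, Nat.bit_true_apply, pow_succ] at h1 h2 ⊢ <;>
          omega
      have hk0 : k ≠ 0 := (lt_of_lt_of_le (by positivity) hk.1).ne'
      have h3 : dyadicNode k ∈ {t : List Bool | t.length = n} := ih ▸ ⟨k, hk, rfl⟩
      simp only [Set.mem_ofPred_eq] at h3 ⊢
      rw [dyadicNode_bit b hk0, List.length_append, h3, List.length_singleton]
    · intro ht
      have hne : t ≠ [] := by rintro rfl; simp at ht
      have h3 : t.dropLast ∈ {t : List Bool | t.length = n} := by
        simp only [Set.mem_ofPred_eq] at ht ⊢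
        simp [ht]
      rw [← ih] at h3
      obtain ⟨k, hk, hkt⟩ := h3
      have hk0 : k ≠ 0 := (lt_of_lt_of_le (by positivity) hk.1).ne'
      refine ⟨Nat.bit (t.getLast hne) k, ?_, ?_⟩
      · obtain ⟨h1, h2⟩ := hk
        cases t.getLast hne <;>
          simp only [Set.mem_ofPred_eq, Nat.bit_false_apply, Nat.bit_true_apply, pow_succ]
            at h1 h2 ⊢ <;> omega
      · rw [dyadicNode_bit _ hk0, hkt, List.dropLast_append_getLast]

/-- The second property that determines the enumeration: within one level, it increases
lexicographically. -/
theorem dyadicNode_lex (n : ℕ) : ∀ l m : ℕ, 2 ^ n ≤ l → l < m → m < 2 ^ (n + 1) →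
    ∃ k < n, (∀ j < k, (dyadicNode l)[j]? = (dyadicNode m)[j]?) ∧
      (dyadicNode l)[k]? = some false ∧ (dyadicNode m)[k]? = some true := by
  induction n with
  | zero => intro l m h1 h2 h3; simp at h1 h3; omega
  | succ n ih =>
    intro l m h1 h2 h3
    obtain ⟨a, p, rfl⟩ : ∃ b k, l = Nat.bit b k := ⟨_, _, (Nat.bit_bodd_div2 l).symm⟩
    obtain ⟨b, q, rfl⟩ : ∃ b k, m = Nat.bit b k := ⟨_, _, (Nat.bit_bodd_div2 m).symm⟩
    have hp : 2 ^ n ≤ p ∧ p ≤ q ∧ q < 2 ^ (n + 1) ∧ (p = q → a = false ∧ b = true) := by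
      cases a <;> cases b <;>
        simp only [Nat.bit_false_apply, Nat.bit_true_apply, pow_succ] at h1 h2 h3 ⊢ <;>
        refine ⟨by omega, by omega, by omega, fun h => ?_⟩ <;> first | omega | simp
    obtain ⟨hp1, hpq, hq, hab⟩ := hp
    have hp0 : p ≠ 0 := (lt_of_lt_of_le (by positivity) hp1).ne'
    have hq0 : q ≠ 0 := by omega
    have hlen : ∀ r, 2 ^ n ≤ r → r < 2 ^ (n + 1) → (dyadicNode r).length = n := by
      intro r hr1 hr2
      have : dyadicNode r ∈ {t : List Bool | t.length = n} :=
        image_dyadicNode n ▸ ⟨r, ⟨hr1, hr2⟩, rfl⟩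
      exact this
    have hlp := hlen p hp1 (by omega)
    have hlq := hlen q (by omega) hq
    rw [dyadicNode_bit a hp0, dyadicNode_bit b hq0]
    rcases hpq.eq_or_lt with rfl | hlt
    · obtain ⟨rfl, rfl⟩ := hab rfl
      refine ⟨n, by omega, fun j hj => ?_, ?_, ?_⟩
      · rw [List.getElem?_append_left (by omega), List.getElem?_append_left (by omega)]
      · rw [List.getElem?_append_right (by omega), hlp]; simp
      · rw [List.getElem?_append_right (by omega), hlp]; simp
    · obtain ⟨k, hk, h4, h5, h6⟩ := ih p q hp1 hlt hq
      refine ⟨k, by omega, fun j hj => ?_, ?_, ?_⟩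
      · rw [List.getElem?_append_left (by omega), List.getElem?_append_left (by omega)]
        exact h4 j hj
      · rw [List.getElem?_append_left (by omega)]; exact h5
      · rw [List.getElem?_append_left (by omega)]; exact h6

/-- `Δ_t`: the infinite `0`-`1` sequences that have `t` as an initial segment. -/
def cylinderSet (t : List Bool) : Set (ℕ → Bool) :=
  {s | ∀ k (hk : k < t.length), s k = t[k]}

theorem isClopen_cylinderSet (t : List Bool) : IsClopen (cylinderSet t) := by
  have h : cylinderSet t = ⋂ k : Fin t.length, (fun s : ℕ → Bool => s k) ⁻¹' {t[k]} := by
    ext s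
    simp [cylinderSet, Fin.forall_iff]
  rw [h]
  exact isClopen_iInter_of_finite fun k => (isClopen_discrete _).preimage (continuous_apply _)

/-- The indicator function of `Δ_t`, as an element of `C({0,1}^ω)`. -/
noncomputable def cylinderChar (𝕜 : Type*) [RCLike 𝕜] (t : List Bool) : C(ℕ → Bool, 𝕜) where
  toFun := (cylinderSet t).indicator 1
  continuous_toFun := continuous_one.indicator (by simp [(isClopen_cylinderSet t).frontier_eq])

/-- The Haar system `(h_m)_{m ≥ 0}` of `C({0,1}^ω)`. -/
noncomputable def haarSystem (𝕜 : Type*) [RCLike 𝕜] : ℕ → C(ℕ → Bool, 𝕜)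
  | 0 => 1
  | m + 1 => cylinderChar 𝕜 (dyadicNode (m + 1) ++ [false]) -
      cylinderChar 𝕜 (dyadicNode (m + 1) ++ [true])

/-! ### Factorization and universality -/

section Operators

variable {𝕜 : Type*} [RCLike 𝕜]
  {W : Type*} [NormedAddCommGroup W] [NormedSpace 𝕜 W]
  {X : Type*} [NormedAddCommGroup X] [NormedSpace 𝕜 X]
  {Y : Type*} [NormedAddCommGroup Y] [NormedSpace 𝕜 Y]
  {Z : Type*} [NormedAddCommGroup Z] [NormedSpace 𝕜 Z]

/-- `S` factors through `T`: there are bounded operators `U`, `V` with `V T U = S`. -/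
def OperatorFactorsThrough (S : W →L[𝕜] Z) (T : X →L[𝕜] Y) : Prop :=
  ∃ (U : W →L[𝕜] X) (V : Y →L[𝕜] Z), V ∘L T ∘L U = S

/-- The Banach space adjoint `T* : Y* → X*`, `T* φ = φ ∘ T`, between the norm duals. -/
noncomputable def banachAdjoint (T : X →L[𝕜] Y) : StrongDual 𝕜 Y →L[𝕜] StrongDual 𝕜 X :=
  T.precomp 𝕜

/-- `T` belongs to the class of operators that have a separable codomain and an adjoint whose
range is not (norm) separable. -/
def SepCodomainNonsepAdjoint (T : X →L[𝕜] Y) : Prop :=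
  SeparableSpace Y ∧ ¬ IsSeparable (Set.range (banachAdjoint T))

end Operators

/-- `S` is universal for the class of operators between Banach spaces over `𝕜` that have separable
codomain and adjoint with non-separable range: it belongs to the class and factors through every
member of the class. -/
def IsUniversalSepCodomainNonsepAdjoint {𝕜 : Type w} [RCLike 𝕜]
    {W : Type w₂} [NormedAddCommGroup W] [NormedSpace 𝕜 W] [CompleteSpace W]
    {Z : Type w₃} [NormedAddCommGroup Z] [NormedSpace 𝕜 Z] [CompleteSpace Z]
    (S : W →L[𝕜] Z) : Prop :=
  SepCodomainNonsepAdjoint S ∧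
    ∀ (X : Type u) [NormedAddCommGroup X] [NormedSpace 𝕜 X] [CompleteSpace X]
      (Y : Type v) [NormedAddCommGroup Y] [NormedSpace 𝕜 Y] [CompleteSpace Y]
      (T : X →L[𝕜] Y), SepCodomainNonsepAdjoint T → OperatorFactorsThrough S T

/-- `J : ℓ₁ → C({0,1}^ω)` sends the `m`-th unit vector to the `m`-th Haar function. Coordinates of
`ℓ₁` are counted from `0` here; counted from `1`, this reads `J e_m = h_{m-1}` for `m ≥ 1`. -/
def MapsUnitVectorsToHaar {𝕜 : Type*} [RCLike 𝕜]
    (J : lp (fun _ : ℕ => 𝕜) 1 →L[𝕜] C(ℕ → Bool, 𝕜)) : Prop :=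
  ∀ m : ℕ, J (lp.single 1 m (1 : 𝕜)) = haarSystem 𝕜 m

/-! ### Recursive construction of sequences -/

/-! The plan is to grow a copy of the Haar system along a dyadic tree of functionals on `Y`. Since
`Y` is separable, its dual balls are weak* compact and metrizable. If the range of `T*` is not
separable, a Cantor–Bendixson argument (`exists_weakStar_dense_in_itself`) gives `δ > 0` and a
bounded set `A` of functionals in which every weak* neighbourhood of a point contains functionals
whose images under `T*` are `δ`-far from any prescribed separable set. So each node can receive two
children in `A` that are weak*-close to it, while their images under `T*` are far from the span of
the images already present. Hahn–Banach then gives `x_m` in `X`, bounded uniformly in `m`, such that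
`T x_m` is killed by all earlier functionals and takes the values `1` and `-1` at the two children
(`exists_haar_tree`). Limits along branches define `V : Y → C({0,1}^ω)`, and `V T x_m` is
exponentially close to `h_m` (`exists_approx_haar_factorization`). The biorthogonal functionals of
the Haar system turn this into equality by a small perturbation (`exists_map_eq_haarSystem`).
Sending `e_m` to `x_m` completes the factorization. That `J` lies in the class is seen from the
point evaluations, whose images under `J*` form an uncountable separated family. -/

theorem exists_seq_of_forall_initial {α : Type*} (Q : ∀ m : ℕ, (∀ j < m, α) → α → Prop)
    (h : ∀ m p, ∃ d, Q m p d) : ∃ f : ℕ → α, ∀ m, Q m (fun j _ => f j) (f m) := by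
  choose g hg using h
  refine ⟨fun m => Nat.strongRec (fun m ih => g m ih) m, fun m => ?_⟩
  have := hg m (fun j _ => Nat.strongRec (motive := fun _ => α) (fun m ih => g m ih) j)
  beta_reduce
  rwa [Nat.strongRec_eq _ m]

/-! ### Sets that are close to a separable set -/

section ApproxSeparable

variable {E : Type*} [PseudoMetricSpace E]

/-- `S` lies within distance `δ` of a separable set. -/
def IsApproxSeparable (δ : ℝ) (S : Set E) : Prop :=
  ∃ F : Set E, IsSeparable F ∧ ∀ a ∈ S, ∃ f ∈ F, dist a f ≤ δ

theorem IsApproxSeparable.mono {δ : ℝ} {S S' : Set E} (h : IsApproxSeparable δ S)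
    (hS : S' ⊆ S) : IsApproxSeparable δ S' :=
  let ⟨F, hF, hF'⟩ := h
  ⟨F, hF, fun a ha => hF' a (hS ha)⟩

theorem IsApproxSeparable.iUnion {ι : Sort*} [Countable ι] {δ : ℝ} {S : ι → Set E}
    (h : ∀ i, IsApproxSeparable δ (S i)) : IsApproxSeparable δ (⋃ i, S i) := by
  choose F hF hF' using h
  refine ⟨⋃ i, F i, .iUnion hF, fun a ha => ?_⟩
  obtain ⟨i, hi⟩ := Set.mem_iUnion.1 ha
  obtain ⟨f, hf, hd⟩ := hF' i a hi
  exact ⟨f, Set.mem_iUnion.2 ⟨i, hf⟩, hd⟩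

theorem IsApproxSeparable.union {δ : ℝ} {S S' : Set E} (h : IsApproxSeparable δ S)
    (h' : IsApproxSeparable δ S') : IsApproxSeparable δ (S ∪ S') := by
  rw [Set.union_eq_iUnion]
  exact .iUnion fun b => by cases b <;> assumption

/-- Used in the contrapositive: non-separability is already witnessed at one fixed scale `δ`. -/
theorem isSeparable_of_isApproxSeparable {S : Set E} (h : ∀ δ > 0, IsApproxSeparable δ S) :
    IsSeparable S := by
  choose F hF hF' using fun n : ℕ => h (1 / ((n : ℝ) + 1)) (by positivity)
  refine (IsSeparable.iUnion hF).closure.mono fun a ha => Metric.mem_closure_iff.2 fun ε hε => ?_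
  obtain ⟨n, hn⟩ := exists_nat_one_div_lt hε
  obtain ⟨f, hf, hd⟩ := hF' n a ha
  exact ⟨f, Set.mem_iUnion.2 ⟨n, hf⟩, hd.trans_lt hn⟩

/-- The points all of whose neighbourhoods have an image that is not close to a separable set. -/
theorem exists_nonempty_forall_not_isApproxSeparable {K : Type*} [TopologicalSpace K]
    [SecondCountableTopology K] {δ : ℝ} {g : K → E}
    (h : ¬ IsApproxSeparable δ (Set.range g)) :
    ∃ A : Set K, A.Nonempty ∧ ∀ a ∈ A, ∀ U, IsOpen U → a ∈ U →
      ¬ IsApproxSeparable δ (g '' (U ∩ A)) := by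
  -- By the Lindelöf property, the union `D` of all open sets with small image is a countable union
  -- of such sets, so its image is small too. Its complement is the required kernel: removing `D`
  -- cannot make a large image small.
  obtain ⟨𝒯, h𝒯, hsub, heq⟩ := isOpen_sUnion_countable
    {U : Set K | IsOpen U ∧ IsApproxSeparable δ (g '' U)} fun U hU => hU.1
  set D := ⋃₀ {U : Set K | IsOpen U ∧ IsApproxSeparable δ (g '' U)} with hD
  have hsmall : IsApproxSeparable δ (g '' D) := by
    have := h𝒯.to_subtype
    rw [← heq, Set.sUnion_eq_iUnion, Set.image_iUnion]
    exact .iUnion fun U => (hsub U.2).2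
  have key : ∀ U, ¬ IsApproxSeparable δ (g '' U) → ¬ IsApproxSeparable δ (g '' (U ∩ Dᶜ)) := by
    intro U hU h'
    refine hU ((h'.union hsmall).mono ?_)
    rw [← Set.image_union]
    refine Set.image_mono fun x hx => ?_
    by_cases hxD : x ∈ D
    · exact .inr hxD
    · exact .inl ⟨hx, hxD⟩
  refine ⟨Dᶜ, ?_, fun a ha U hU haU => key U fun h' => ha ⟨U, ⟨hU, h'⟩, haU⟩⟩
  by_contra hne
  refine key Set.univ (by rwa [Set.image_univ]) ?_
  rw [Set.univ_inter, Set.not_nonempty_iff_eq_empty.1 hne, Set.image_empty]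
  exact ⟨∅, Set.countable_empty.isSeparable, by simp⟩

end ApproxSeparable

section Duality

variable {𝕜 : Type*} [RCLike 𝕜]
  {X : Type*} [NormedAddCommGroup X] [NormedSpace 𝕜 X]
  {Y : Type*} [NormedAddCommGroup Y] [NormedSpace 𝕜 Y]

/-- A functional at distance more than `δ` from the span of finitely many others takes the value
`1` at a common zero of these of norm at most `1 / δ`. -/
theorem exists_apply_eq_one_of_dist_span {ι : Type*} [Finite ι] (g : ι → StrongDual 𝕜 X)
    (f : StrongDual 𝕜 X) {δ : ℝ} (hδ : 0 < δ)
    (hf : ∀ φ ∈ Submodule.span 𝕜 (Set.range g), δ < dist f φ) :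
    ∃ x : X, ‖x‖ ≤ 1 / δ ∧ (∀ i, g i x = 0) ∧ f x = 1 := by
  let p : Subspace 𝕜 X := ⨅ i, LinearMap.ker (g i : X →ₗ[𝕜] 𝕜)
  -- On the common kernel `p`, extend `f` to `F` by Hahn–Banach. Then `f - F` vanishes on `p`, hence
  -- lies in the span, and `‖f|p‖ = ‖F‖ = dist f (f - F) > δ`.
  obtain ⟨F, hF, hFn⟩ := exists_extension_norm_eq p (f ∘L p.subtypeL)
  have hmem : (f - F : StrongDual 𝕜 X) ∈ Submodule.span 𝕜 (Set.range g) := by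
    have h1 : ((f - F : StrongDual 𝕜 X) : X →ₗ[𝕜] 𝕜) ∈
        Submodule.span 𝕜 (Set.range fun i => (g i : X →ₗ[𝕜] 𝕜)) := by
      refine mem_span_of_iInf_ker_le_ker fun x hx => ?_
      have := hF ⟨x, hx⟩
      simp_all
    have h2 : (Set.range fun i => (g i : X →ₗ[𝕜] 𝕜)) =
        ContinuousLinearMap.coeLM 𝕜 '' Set.range g := by
      rw [← Set.range_comp]; rfl
    rw [h2, Submodule.span_image] at h1
    obtain ⟨φ, hφ, hφe⟩ := h1
    have : φ = f - F := ContinuousLinearMap.coe_injective hφe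
    exact this ▸ hφ
  have hδF : δ < ‖f ∘L p.subtypeL‖ := by
    have := hf _ hmem
    rwa [dist_eq_norm, sub_sub_cancel, hFn] at this
  obtain ⟨z, hz⟩ : ∃ z : p, δ * ‖z‖ < ‖f z‖ := by
    by_contra! hcon
    exact absurd (ContinuousLinearMap.opNorm_le_bound _ hδ.le hcon) (not_le.2 hδF)
  have hfz : 0 < ‖f z‖ := lt_of_le_of_lt (by positivity) hz
  refine ⟨(f z)⁻¹ • (z : X), ?_, fun i => ?_, ?_⟩
  · rw [norm_smul, norm_inv, inv_mul_le_iff₀ hfz, mul_one_div, le_div_iff₀ hδ, mul_comm]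
    exact hz.le
  · have := (Submodule.mem_iInf _).1 z.2 i
    simp_all
  · simp [norm_pos_iff.1 hfz]

/-- Take `z` for `f` over `g`, and `z'` for `f'` over `g` together with `f`. Subtracting a multiple
of `z'` from `z` adjusts the value of `f'` without disturbing `f` or `g`. -/
theorem exists_separating_vector {ι : Type*} [Finite ι] (g : ι → StrongDual 𝕜 X)
    (f f' : StrongDual 𝕜 X) {δ M : ℝ} (hδ : 0 < δ) (hM : ‖f'‖ ≤ M)
    (hf : ∀ φ ∈ Submodule.span 𝕜 (Set.range g), δ < dist f φ)
    (hf' : ∀ φ ∈ Submodule.span 𝕜 (Set.range fun o : Option ι => o.elim f g), δ < dist f' φ) :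
    ∃ x : X, ‖x‖ ≤ 1 / δ + (1 + M * (1 / δ)) * (1 / δ) ∧ (∀ i, g i x = 0) ∧
      f x = 1 ∧ f' x = -1 := by
  obtain ⟨z, hz, hgz, hfz⟩ := exists_apply_eq_one_of_dist_span g f hδ hf
  obtain ⟨z', hz', hgz', hfz'⟩ := exists_apply_eq_one_of_dist_span _ f' hδ hf'
  refine ⟨z - (1 + f' z) • z', ?_, fun i => ?_, ?_, ?_⟩
  · refine (norm_sub_le _ _).trans (add_le_add hz ?_)
    rw [norm_smul]
    refine mul_le_mul ((norm_add_le _ _).trans (add_le_add (by simp) ?_)) hz' (norm_nonneg _) ?_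
    · exact (f'.le_opNorm z).trans (mul_le_mul hM hz (norm_nonneg _) ((norm_nonneg _).trans hM))
    · have := (norm_nonneg _).trans hM
      positivity
  · have := hgz' (some i)
    simp_all
  · have := hgz' none
    simp_all
  · simp [hfz']

/-- Some ball of `Y*` has a non-separable image under `T*`, and so one not within some `δ` of a
separable set. Separability of `Y` makes this ball second countable in the weak* topology, so the
kernel construction above applies to it. -/
theorem exists_weakStar_dense_in_itself [SeparableSpace Y] (T : X →L[𝕜] Y)
    (hT : ¬ IsSeparable (Set.range (banachAdjoint T))) :
    ∃ δ > 0, ∃ M : ℝ, ∃ A : Set (StrongDual 𝕜 Y), A.Nonempty ∧ (∀ a ∈ A, ‖a‖ ≤ M) ∧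
      ∀ a ∈ A, ∀ E : Set Y, E.Finite → ∀ η > 0, ∀ F : Set (StrongDual 𝕜 X), IsSeparable F →
        ∃ b ∈ A, (∀ y ∈ E, ‖b y - a y‖ < η) ∧ ∀ φ ∈ F, δ < dist (b ∘L T) φ := by
  obtain ⟨n, hn⟩ : ∃ n : ℕ, ¬ IsSeparable (banachAdjoint T '' Metric.closedBall 0 n) := by
    by_contra! hcon
    refine hT ((IsSeparable.iUnion hcon).mono ?_)
    rintro _ ⟨φ, rfl⟩
    obtain ⟨n, hn⟩ := exists_nat_ge ‖φ‖
    exact Set.mem_iUnion.2 ⟨n, φ, by simpa using hn, rfl⟩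
  obtain ⟨δ, hδ, hδn⟩ : ∃ δ > 0,
      ¬ IsApproxSeparable δ (banachAdjoint T '' Metric.closedBall 0 n) := by
    by_contra! hcon
    exact hn (isSeparable_of_isApproxSeparable hcon)
  let K : Set (WeakDual 𝕜 Y) := WeakDual.toStrongDual ⁻¹' Metric.closedBall 0 (n : ℝ)
  have hK : IsCompact K := WeakDual.isCompact_closedBall 0 n
  have := isCompact_iff_compactSpace.1 hK
  have := WeakDual.metrizable_of_isCompact 𝕜 Y K hK
  let _ := metrizableSpaceMetric K
  obtain ⟨A, ⟨a₀, ha₀⟩, hA⟩ := exists_nonempty_forall_not_isApproxSeparable (K := K) (δ := δ)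
    (g := fun a => banachAdjoint T (WeakDual.toStrongDual (a : WeakDual 𝕜 Y))) (by
      convert hδn using 2
      ext φ
      constructor
      · rintro ⟨a, rfl⟩
        exact ⟨_, a.2, rfl⟩
      · rintro ⟨a, ha, rfl⟩
        exact ⟨⟨StrongDual.toWeakDual a, ha⟩, rfl⟩)
  refine ⟨δ, hδ, n, (fun a : K => WeakDual.toStrongDual (a : WeakDual 𝕜 Y)) '' A,
    ⟨_, a₀, ha₀, rfl⟩, ?_, ?_⟩
  · rintro _ ⟨a, -, rfl⟩
    exact mem_closedBall_zero_iff.1 a.2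
  · rintro _ ⟨a, ha, rfl⟩ E hE η hη F hF
    have hU : IsOpen (⋂ y ∈ E, {b : K | ‖(b : WeakDual 𝕜 Y) y - (a : WeakDual 𝕜 Y) y‖ < η}) :=
      hE.isOpen_biInter fun y _ => isOpen_lt
        ((((WeakDual.eval_continuous y).comp continuous_subtype_val).sub continuous_const).norm)
        continuous_const
    have h := hA a ha _ hU (by simp [hη])
    simp only [IsApproxSeparable, not_exists, not_and, not_forall, not_le] at h
    obtain ⟨_, ⟨b, ⟨hbU, hbA⟩, rfl⟩, hb⟩ := h F hF
    refine ⟨_, ⟨b, hbA, rfl⟩, fun y hy => ?_, fun φ hφ => hb φ hφ⟩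
    exact Set.mem_iInter₂.1 hbU y hy

end Duality

/-! ### Paths in the dyadic tree -/

/-- The index in the enumeration `dyadicNode` of the initial segment of length `n` of `s`. -/
def pathIndex (s : ℕ → Bool) : ℕ → ℕ
  | 0 => 1
  | n + 1 => Nat.bit (s n) (pathIndex s n)

theorem two_pow_le_pathIndex (s : ℕ → Bool) (n : ℕ) : 2 ^ n ≤ pathIndex s n := by
  induction n with
  | zero => simp [pathIndex]
  | succ n ih => rw [pathIndex, Nat.bit_val, pow_succ]; omega

theorem pathIndex_lt_two_pow (s : ℕ → Bool) (n : ℕ) : pathIndex s n < 2 ^ (n + 1) := by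
  induction n with
  | zero => simp [pathIndex]
  | succ n ih =>
    rw [pathIndex, Nat.bit_val, pow_succ _ (n + 1)]
    have := Bool.toNat_le (s n)
    omega

theorem lt_pathIndex (s : ℕ → Bool) (n : ℕ) : n < pathIndex s n :=
  Nat.lt_two_pow_self.trans_le (two_pow_le_pathIndex s n)

theorem pathIndex_lt_succ (s : ℕ → Bool) (n : ℕ) : pathIndex s n < pathIndex s (n + 1) := by
  have := lt_pathIndex s n
  rw [pathIndex, Nat.bit_val]; omega

theorem Nat.bit_eq_bit_iff {b b' : Bool} {m m' : ℕ} :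
    Nat.bit b m = Nat.bit b' m' ↔ b = b' ∧ m = m' := by
  simp only [Nat.bit_val]
  cases b <;> cases b' <;> simp <;> omega

theorem continuous_pathIndex (n : ℕ) : Continuous fun s => pathIndex s n := by
  induction n with
  | zero => exact continuous_const
  | succ n ih =>
    exact (continuous_of_discreteTopology (f := fun q : Bool × ℕ => Nat.bit q.1 q.2)).comp
      ((continuous_apply n).prodMk ih)

theorem pathIndex_congr {s s' : ℕ → Bool} {n : ℕ} (h : ∀ k < n, s k = s' k) :
    pathIndex s n = pathIndex s' n := by
  induction n with
  | zero => rfl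
  | succ n ih => rw [pathIndex, pathIndex, ih fun k hk => h k (by omega), h n (by omega)]

theorem eq_of_pathIndex_eq {s s' : ℕ → Bool} {n : ℕ} (h : pathIndex s n = pathIndex s' n) :
    ∀ k < n, s k = s' k := by
  induction n with
  | zero => simp
  | succ n ih =>
    rw [pathIndex, pathIndex, Nat.bit_eq_bit_iff] at h
    intro k hk
    rcases Nat.lt_succ_iff_lt_or_eq.1 hk with hk | rfl
    · exact ih h.2 k hk
    · exact h.1

theorem mem_cylinderSet_append {t : List Bool} {b : Bool} {s : ℕ → Bool} :
    s ∈ cylinderSet (t ++ [b]) ↔ s ∈ cylinderSet t ∧ s t.length = b := by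
  constructor
  · intro h
    refine ⟨fun k hk => ?_, ?_⟩
    · have := h k (by simp; omega)
      rwa [List.getElem_append_left hk] at this
    · simpa using h t.length (by simp)
  · rintro ⟨h, h'⟩ k hk
    rcases Nat.lt_succ_iff_lt_or_eq.1 (show k < t.length + 1 by simpa using hk) with hk' | rfl
    · rw [List.getElem_append_left hk']; exact h k hk'
    · simpa using h'

theorem mem_cylinderSet_dyadicNode {m : ℕ} (hm : m ≠ 0) (s : ℕ → Bool) :
    s ∈ cylinderSet (dyadicNode m) ↔ pathIndex s (dyadicNode m).length = m := by
  induction m using Nat.binaryRec' with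
  | zero => exact absurd rfl hm
  | bit b m hb ih =>
    rcases eq_or_ne m 0 with rfl | hm'
    -- The root `m = 1` is `Nat.bit true 0`, the base case of the recursion.
    · obtain rfl := hb rfl
      simp [dyadicNode_one, cylinderSet, pathIndex]
    · rw [dyadicNode_bit b hm', mem_cylinderSet_append, ih hm', List.length_append,
        List.length_singleton, pathIndex, Nat.bit_eq_bit_iff, and_comm]

theorem two_pow_length_dyadicNode_le {m : ℕ} (hm : m ≠ 0) :
    2 ^ (dyadicNode m).length ≤ m ∧ m < 2 ^ ((dyadicNode m).length + 1) := by
  obtain ⟨s, hs⟩ : (cylinderSet (dyadicNode m)).Nonempty :=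
    ⟨fun k => (dyadicNode m).getD k false, fun k hk => by simp [hk]⟩
  have h := (mem_cylinderSet_dyadicNode hm s).1 hs
  have h1 := two_pow_le_pathIndex s (dyadicNode m).length
  have h2 := pathIndex_lt_two_pow s (dyadicNode m).length
  rw [h] at h1 h2
  exact ⟨h1, h2⟩

section Haar

variable (𝕜 : Type*) [RCLike 𝕜]

open Classical in
theorem haarSystem_apply {m : ℕ} (hm : m ≠ 0) (s : ℕ → Bool) :
    haarSystem 𝕜 m s = if pathIndex s (dyadicNode m).length = m then
      (if s (dyadicNode m).length then -1 else 1) else 0 := by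
  obtain ⟨m, rfl⟩ := Nat.exists_eq_succ_of_ne_zero hm
  simp only [← mem_cylinderSet_dyadicNode hm, haarSystem, cylinderChar, ContinuousMap.sub_apply, ContinuousMap.coe_mk,
    Set.indicator_apply, mem_cylinderSet_append, Pi.one_apply]
  by_cases h : s ∈ cylinderSet (dyadicNode (m + 1)) <;>
    cases h' : s (dyadicNode (m + 1)).length <;> simp_all

theorem norm_haarSystem_le (m : ℕ) : ‖haarSystem 𝕜 m‖ ≤ 1 := by
  refine (ContinuousMap.norm_le _ zero_le_one).2 fun s => ?_
  rcases eq_or_ne m 0 with rfl | hm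
  · simp [haarSystem]
  · rw [haarSystem_apply 𝕜 hm]
    split_ifs <;> simp

/-! ### The biorthogonal functionals of the Haar system -/

open MeasureTheory

/-- The uniform probability measure on the Cantor space. -/
noncomputable def cantorMeasure : Measure (ℕ → Bool) :=
  Measure.infinitePi fun _ => (PMF.uniformOfFintype Bool).toMeasure

instance : IsProbabilityMeasure cantorMeasure := by
  unfold cantorMeasure; infer_instance

theorem cantorMeasure_real_cylinderSet (t : List Bool) :
    cantorMeasure.real (cylinderSet t) = (1 / 2) ^ t.length := by
  have h : cylinderSet t =
      Set.pi (Finset.range t.length) fun k => {b : Bool | b = t.getD k false} := by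
    ext s
    simp only [cylinderSet, Set.mem_ofPred_eq, Set.mem_pi, Finset.coe_range, Set.mem_Iio]
    exact forall₂_congr fun k hk => by simp [hk]
  rw [h, measureReal_def, cantorMeasure, Measure.infinitePi_pi _ fun _ _ => .of_discrete]
  have : ∀ k, (PMF.uniformOfFintype Bool).toMeasure {b : Bool | b = t.getD k false} = 2⁻¹ := by
    intro k
    change (PMF.uniformOfFintype Bool).toMeasure {t.getD k false} = 2⁻¹
    rw [PMF.toMeasure_apply_singleton _ _ (.of_discrete)]
    simp
  simp

theorem integrable_cantorMeasure (f : C(ℕ → Bool, 𝕜)) : Integrable f cantorMeasure :=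
  f.continuous.integrable_of_hasCompactSupport (.of_compactSpace f)

theorem integral_cylinderChar (t : List Bool) :
    ∫ s, cylinderChar 𝕜 t s ∂cantorMeasure = (1 / 2) ^ t.length := by
  change ∫ s, (cylinderSet t).indicator 1 s ∂cantorMeasure = _
  rw [integral_indicator (isClopen_cylinderSet t).1.measurableSet]
  simp [RCLike.real_smul_eq_coe_mul, RCLike.algebraMap_eq_ofReal, cantorMeasure_real_cylinderSet,
    map_ofNat (algebraMap ℝ 𝕜)]

theorem integral_haarSystem {m : ℕ} (hm : m ≠ 0) :
    ∫ s, haarSystem 𝕜 m s ∂cantorMeasure = 0 := by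
  obtain ⟨m, rfl⟩ := Nat.exists_eq_succ_of_ne_zero hm
  simp only [haarSystem, ContinuousMap.sub_apply]
  rw [integral_sub (integrable_cantorMeasure 𝕜 _) (integrable_cantorMeasure 𝕜 _),
    integral_cylinderChar, integral_cylinderChar]
  simp

theorem integral_haarSystem_mul_self (m : ℕ) :
    ∫ s, haarSystem 𝕜 m s * haarSystem 𝕜 m s ∂cantorMeasure =
      (1 / 2) ^ (dyadicNode m).length := by
  rcases eq_or_ne m 0 with rfl | hm
  · simp [haarSystem, dyadicNode]
  · rw [← integral_cylinderChar]
    congr 1 with s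
    rw [haarSystem_apply 𝕜 hm]
    change _ = (cylinderSet (dyadicNode m)).indicator 1 s
    classical
    simp only [Set.indicator_apply, mem_cylinderSet_dyadicNode hm]
    split_ifs <;> simp

/-- The function `h_k` is constant on the support of `h_m`, which has mean zero. The case `k = 0` is
separate because `dyadicNode 0` and `dyadicNode 1` are both empty. -/
theorem integral_haarSystem_mul_of_lt {k m : ℕ}
    (h : k = 0 ∨ (dyadicNode k).length < (dyadicNode m).length) (hm : m ≠ 0) :
    ∫ s, haarSystem 𝕜 k s * haarSystem 𝕜 m s ∂cantorMeasure = 0 := by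
  obtain ⟨c, hc⟩ : ∃ c, ∀ s, haarSystem 𝕜 k s * haarSystem 𝕜 m s = c * haarSystem 𝕜 m s := by
    obtain ⟨s₀, hs₀⟩ : (cylinderSet (dyadicNode m)).Nonempty :=
      ⟨fun k => (dyadicNode m).getD k false, fun k hk => by simp [hk]⟩
    refine ⟨haarSystem 𝕜 k s₀, fun s => ?_⟩
    by_cases hs : pathIndex s (dyadicNode m).length = m
    · congr 1
      rcases eq_or_ne k 0 with rfl | hk
      · rfl
      have h := h.resolve_left hk
      have heq := eq_of_pathIndex_eq (hs.trans ((mem_cylinderSet_dyadicNode hm s₀).1 hs₀).symm)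
      rw [haarSystem_apply 𝕜 hk, haarSystem_apply 𝕜 hk, heq _ h,
        pathIndex_congr fun j hj => heq j (hj.trans h)]
    · rw [haarSystem_apply 𝕜 hm, if_neg hs]; simp
  simp only [hc]
  rw [integral_const_mul, integral_haarSystem 𝕜 hm, mul_zero]

theorem integral_haarSystem_mul {k m : ℕ} (hkm : k ≠ m) :
    ∫ s, haarSystem 𝕜 k s * haarSystem 𝕜 m s ∂cantorMeasure = 0 := by
  rcases eq_or_ne m 0 with rfl | hm
  · simp_rw [mul_comm (haarSystem 𝕜 k _)]
    exact integral_haarSystem_mul_of_lt 𝕜 (.inl rfl) hkm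
  rcases eq_or_ne k 0 with rfl | hk
  · exact integral_haarSystem_mul_of_lt 𝕜 (.inl rfl) hm
  rcases lt_trichotomy (dyadicNode k).length (dyadicNode m).length with h | h | h
  · exact integral_haarSystem_mul_of_lt 𝕜 (.inr h) hm
  · have : ∀ s, haarSystem 𝕜 k s * haarSystem 𝕜 m s = 0 := by
      intro s
      rw [haarSystem_apply 𝕜 hm, haarSystem_apply 𝕜 hk, h]
      by_cases h1 : pathIndex s (dyadicNode m).length = k
      · rw [if_neg (h1.symm ▸ hkm : pathIndex s (dyadicNode m).length ≠ m), mul_zero]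
      · rw [if_neg h1, zero_mul]
    simp [this]
  · simp_rw [mul_comm (haarSystem 𝕜 k _)]
    exact integral_haarSystem_mul_of_lt 𝕜 (.inr h) hk

/-- Integrate against `h_m` and normalise by `2 ^ (dyadicNode m).length`. The bound `2 ^ m` is crude
but suffices against errors of order `8 ^ (-m)`. -/
theorem exists_haarSystem_biorthogonal :
    ∃ g : ℕ → StrongDual 𝕜 C(ℕ → Bool, 𝕜), (∀ m, ‖g m‖ ≤ 2 ^ m) ∧
      (∀ m, g m (haarSystem 𝕜 m) = 1) ∧ ∀ k m, k ≠ m → g m (haarSystem 𝕜 k) = 0 := by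
  let L : ∀ m, C(ℕ → Bool, 𝕜) →ₗ[𝕜] 𝕜 := fun m =>
    { toFun := fun f => 2 ^ (dyadicNode m).length * ∫ s, f s * haarSystem 𝕜 m s ∂cantorMeasure
      map_add' := fun f f' => by
        have := integral_add (integrable_cantorMeasure 𝕜 (f * haarSystem 𝕜 m))
          (integrable_cantorMeasure 𝕜 (f' * haarSystem 𝕜 m))
        simp only [ContinuousMap.mul_apply] at this
        simp only [ContinuousMap.add_apply, add_mul, this, mul_add]
      map_smul' := fun c f => by
        simp only [ContinuousMap.smul_apply, smul_eq_mul, mul_assoc, integral_const_mul,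
          RingHom.id_apply]
        ring }
  have hL : ∀ m f, ‖L m f‖ ≤ 2 ^ m * ‖f‖ := by
    intro m f
    change ‖(2 : 𝕜) ^ (dyadicNode m).length * ∫ s, f s * haarSystem 𝕜 m s ∂cantorMeasure‖ ≤ _
    rw [norm_mul]
    refine mul_le_mul ?_ ?_ (norm_nonneg _) (by positivity)
    · rw [norm_pow, RCLike.norm_ofNat]
      refine pow_le_pow_right₀ one_le_two ?_
      rcases eq_or_ne m 0 with rfl | hm
      · simp [dyadicNode]
      · exact Nat.lt_two_pow_self.le.trans (two_pow_length_dyadicNode_le hm).1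
    · have := norm_integral_le_of_norm_le_const (μ := cantorMeasure) (C := ‖f‖)
        (f := fun s => f s * haarSystem 𝕜 m s) (.of_forall fun s => by
          rw [norm_mul]
          exact (mul_le_mul_of_nonneg_left (((haarSystem 𝕜 m).norm_coe_le_norm s).trans
            (norm_haarSystem_le 𝕜 m)) (norm_nonneg _)).trans
              ((mul_one _).trans_le (f.norm_coe_le_norm s)))
      simpa using this
  refine ⟨fun m => (L m).mkContinuous (2 ^ m) (hL m), fun m => ?_, fun m => ?_, fun k m h => ?_⟩
  · exact LinearMap.mkContinuous_norm_le _ (by positivity) _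
  · change (2 : 𝕜) ^ (dyadicNode m).length * _ = 1
    rw [integral_haarSystem_mul_self, ← mul_pow]; simp
  · change (2 : 𝕜) ^ (dyadicNode m).length * _ = 0
    rw [integral_haarSystem_mul 𝕜 h, mul_zero]

end Haar

/-! ### Haar-like trees of functionals -/

section Tree

variable {𝕜 : Type*} [RCLike 𝕜]
  {X : Type*} [NormedAddCommGroup X] [NormedSpace 𝕜 X]
  {Y : Type*} [NormedAddCommGroup Y] [NormedSpace 𝕜 Y]

theorem isSeparable_span_range {E : Type*} [NormedAddCommGroup E] [NormedSpace 𝕜 E]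
    {ι : Type*} [Finite ι] (g : ι → E) :
    IsSeparable (Submodule.span 𝕜 (Set.range g) : Set E) :=
  (Set.finite_range g).countable.isSeparable.span

/-- Node `m` has children `2m` and `2m + 1`. Stage `m` chooses `c (2m)`, `c (2m + 1)` and `x m`
together, when exactly the functionals of index below `2m` exist. The closeness conditions, at the
first `m` points `y k` and at the earlier `T (x k)`, make branches converge and preserve the values
already arranged. -/
theorem exists_haar_tree [SeparableSpace Y] (T : X →L[𝕜] Y)
    (hT : ¬ IsSeparable (Set.range (banachAdjoint T))) {ε : ℕ → ℝ} (hε : ∀ m, 0 < ε m)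
    (y : ℕ → Y) :
    ∃ (C M : ℝ) (c : ℕ → StrongDual 𝕜 Y) (x : ℕ → X), (∀ j, ‖c j‖ ≤ M) ∧ (∀ m, ‖x m‖ ≤ C) ∧
      c 1 (T (x 0)) = 1 ∧
      (∀ m ≠ 0, ∀ e : Bool, c (Nat.bit e m) (T (x m)) = if e then -1 else 1) ∧
      (∀ m, ∀ j < 2 * m, c j (T (x m)) = 0) ∧
      ∀ m ≠ 0, ∀ e : Bool, ∀ k < m, ‖c (Nat.bit e m) (y k) - c m (y k)‖ < ε m ∧
        ‖c (Nat.bit e m) (T (x k)) - c m (T (x k))‖ < ε m := by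
  obtain ⟨δ, hδ, M, A, ⟨a₀, ha₀⟩, hAM, hA⟩ := exists_weakStar_dense_in_itself T hT
  have hM : 0 ≤ M := (norm_nonneg _).trans (hAM a₀ ha₀)
  -- The bound of `exists_separating_vector`, with `‖b' ∘L T‖ ≤ M * ‖T‖`.
  set C := 1 / δ + (1 + M * ‖T‖ * (1 / δ)) * (1 / δ) with hC
  let α := {p : StrongDual 𝕜 Y × StrongDual 𝕜 Y × X // p.1 ∈ A ∧ p.2.1 ∈ A ∧ ‖p.2.2‖ ≤ C}
  let ch : α → Bool → StrongDual 𝕜 Y := fun d e => cond e d.1.2.1 d.1.1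
  have hch : ∀ d e, ch d e ∈ A := by
    rintro d (_ | _)
    exacts [d.2.1, d.2.2.1]
  let v : α → X := fun d => d.1.2.2
  obtain ⟨f, hf⟩ := exists_seq_of_forall_initial (α := α) (fun m p d =>
    (m = 0 → ch d true (T (v d)) = 1) ∧
    (m ≠ 0 → ∀ e, ch d e (T (v d)) = if e then -1 else 1) ∧
    (∀ i (hi : i < m) e, ch (p i hi) e (T (v d)) = 0) ∧
    ∀ hm : m ≠ 0, ∀ e, ∀ k (hk : k < m),
      ‖ch d e (y k) - ch (p (m / 2) (by omega)) m.bodd (y k)‖ < ε m ∧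
      ‖ch d e (T (v (p k hk))) - ch (p (m / 2) (by omega)) m.bodd (T (v (p k hk)))‖ < ε m) (by
    intro m p
    rcases eq_or_ne m 0 with rfl | hm
    · obtain ⟨b, hb, -, hbd⟩ := hA a₀ ha₀ ∅ Set.finite_empty 1 one_pos _
        (isSeparable_span_range (𝕜 := 𝕜) (Empty.elim : Empty → StrongDual 𝕜 X))
      obtain ⟨x, hx, -, hbx⟩ := exists_apply_eq_one_of_dist_span _ _ hδ hbd
      -- Stage `0` only has to supply the root `c 1`; `c 0` is a dummy copy of it that lies on no
      -- branch.
      refine ⟨⟨(b, b, x), hb, hb, hx.trans ?_⟩, fun _ => hbx, by simp, by simp, by simp⟩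
      rw [hC]
      exact le_add_of_nonneg_right (by positivity)
    · have hm2 : m / 2 < m := by omega
      let a := ch (p (m / 2) hm2) m.bodd
      let E : Set Y := Set.range (fun k : Fin m => y k) ∪
        Set.range (fun k : Fin m => T (v (p k k.2)))
      have hE : E.Finite := (Set.finite_range _).union (Set.finite_range _)
      let g : Fin m × Bool → StrongDual 𝕜 X := fun i => ch (p i.1 i.1.2) i.2 ∘L T
      obtain ⟨b, hb, hbE, hbd⟩ := hA a (hch _ _) E hE (ε m) (hε m) _
        (isSeparable_span_range (𝕜 := 𝕜) g)
      obtain ⟨b', hb', hbE', hbd'⟩ := hA a (hch _ _) E hE (ε m) (hε m) _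
        (isSeparable_span_range (𝕜 := 𝕜) fun o : Option (Fin m × Bool) => o.elim (b ∘L T) g)
      obtain ⟨x, hx, hgx, hbx, hbx'⟩ := exists_separating_vector g (b ∘L T) (b' ∘L T) hδ
        ((b'.opNorm_comp_le T).trans (mul_le_mul_of_nonneg_right (hAM b' hb') (norm_nonneg _)))
        hbd hbd'
      refine ⟨⟨(b, b', x), hb, hb', hx⟩, fun h => absurd h hm, ?_, ?_, ?_⟩
      · rintro - (_ | _)
        exacts [hbx, hbx']
      · exact fun i hi e => hgx (⟨i, hi⟩, e)
      · rintro - (_ | _) k hk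
        exacts [⟨hbE _ (.inl ⟨⟨k, hk⟩, rfl⟩), hbE _ (.inr ⟨⟨k, hk⟩, rfl⟩)⟩,
          ⟨hbE' _ (.inl ⟨⟨k, hk⟩, rfl⟩), hbE' _ (.inr ⟨⟨k, hk⟩, rfl⟩)⟩])
  refine ⟨C, M, fun j => ch (f (j / 2)) j.bodd, fun m => v (f m), fun j => hAM _ (hch _ _),
    fun m => (f m).2.2.2, by simpa using (hf 0).1 rfl, fun m hm e => ?_, fun m j hj => ?_, fun m hm e k hk => ?_⟩
  · have := (hf m).2.1 hm e
    simpa [Nat.bit_div_two] using this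
  · exact (hf m).2.2.1 _ (by omega) _
  · have := (hf m).2.2.2 hm e k hk
    simpa [Nat.bit_div_two] using this

/-! ### The limit operator of a tree of functionals -/

/-- The continuous function `s ↦ c (pathIndex s n) y`, linear in `y`. -/
noncomputable def treeOperator (c : ℕ → StrongDual 𝕜 Y) {M : ℝ} (hM : ∀ j, ‖c j‖ ≤ M) (n : ℕ) :
    Y →L[𝕜] C(ℕ → Bool, 𝕜) :=
  LinearMap.mkContinuous
    { toFun := fun y => ⟨fun s => c (pathIndex s n) y,
        (continuous_of_discreteTopology (f := fun j => c j y)).comp (continuous_pathIndex n)⟩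
      map_add' := fun y y' => by ext s; simp
      map_smul' := fun r y => by ext s; simp } M fun y =>
    (ContinuousMap.norm_le _ (mul_nonneg ((norm_nonneg _).trans (hM 0)) (norm_nonneg _))).2
      fun _ => (c _).le_of_opNorm_le (hM _) y

theorem treeOperator_apply (c : ℕ → StrongDual 𝕜 Y) {M : ℝ} (hM : ∀ j, ‖c j‖ ≤ M) (n : ℕ)
    (y : Y) (s : ℕ → Bool) : treeOperator c hM n y s = c (pathIndex s n) y := rfl

theorem norm_treeOperator_le (c : ℕ → StrongDual 𝕜 Y) {M : ℝ} (hM : ∀ j, ‖c j‖ ≤ M) (n : ℕ) :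
    ‖treeOperator c hM n‖ ≤ M :=
  LinearMap.mkContinuous_norm_le _ ((norm_nonneg _).trans (hM 0)) _

/-- A bounded sequence of operators that is Cauchy on a dense set converges pointwise. -/
theorem exists_tendsto_of_cauchySeq_dense {Z : Type*} [NormedAddCommGroup Z] [NormedSpace 𝕜 Z]
    [CompleteSpace Y] [CompleteSpace Z] (V : ℕ → Y →L[𝕜] Z) {M : ℝ} (hM : ∀ n, ‖V n‖ ≤ M)
    {D : Set Y} (hD : Dense D) (h : ∀ y ∈ D, CauchySeq fun n => V n y) :
    ∃ W : Y →L[𝕜] Z, ∀ y, Filter.Tendsto (fun n => V n y) Filter.atTop (nhds (W y)) := by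
  have hM0 : 0 ≤ M := (norm_nonneg _).trans (hM 0)
  have hc : ∀ y, CauchySeq fun n => V n y := by
    refine fun y => Metric.cauchySeq_iff'.2 fun η hη => ?_
    obtain ⟨z, hz, hyz⟩ := hD.exists_dist_lt y (show 0 < η / (3 * (M + 1)) by positivity)
    obtain ⟨N, hN⟩ := Metric.cauchySeq_iff'.1 (h z hz) (η / 3) (by positivity)
    have hd : ∀ n, dist (V n y) (V n z) < η / 3 := fun n => by
      rw [dist_eq_norm, ← map_sub]
      have h1 := (V n).le_of_opNorm_le (hM n) (y - z)
      rw [dist_eq_norm, lt_div_iff₀ (by positivity)] at hyz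
      nlinarith [norm_nonneg (y - z)]
    refine ⟨N, fun n hn => ?_⟩
    have h1 := dist_triangle4 (V n y) (V n z) (V N z) (V N y)
    have h2 := hd n
    have h3 := hd N
    have h4 := hN n hn
    rw [dist_comm] at h3
    linarith
  choose W hW using fun y => cauchySeq_tendsto_of_complete (hc y)
  exact ⟨continuousLinearMapOfTendsto V (tendsto_pi_nhds.2 hW), hW⟩

/-- `V y` is the uniform limit of `s ↦ c (pathIndex s n) y`. Indices increase strictly along a
branch, so the errors made after stage `m` sum to at most `∑_{j > m} 8 ^ (-j) = 8 ^ (-m) / 7`. -/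
theorem exists_approx_haar_factorization [SeparableSpace Y] [CompleteSpace Y] (T : X →L[𝕜] Y)
    (hT : ¬ IsSeparable (Set.range (banachAdjoint T))) :
    ∃ (C : ℝ) (x : ℕ → X) (V : Y →L[𝕜] C(ℕ → Bool, 𝕜)), (∀ m, ‖x m‖ ≤ C) ∧
      ∀ m, ‖V (T (x m)) - haarSystem 𝕜 m‖ ≤ (1 / 8) ^ m / 7 := by
  obtain ⟨C, M, c, x, hcM, hxC, hroot, hself, hzero, hclose⟩ :=
    exists_haar_tree T hT (ε := fun m => (1 / 8 : ℝ) ^ m) (fun m => by positivity) (denseSeq Y)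
  have hpath : ∀ s n, pathIndex s n ≠ 0 := fun s n => (Nat.zero_lt_of_lt (lt_pathIndex s n)).ne'
  have hcauchy : ∀ y ∈ Set.range (denseSeq Y), CauchySeq fun n => treeOperator c hcM n y := by
    rintro _ ⟨k, rfl⟩
    -- From level `k` on, every node index exceeds `k`, so the closeness condition covers the point
    -- `y k`.
    refine (cauchySeq_shift k).1 (cauchySeq_of_le_geometric (1 / 8) 1 (by norm_num) fun n => ?_)
    rw [dist_comm, dist_eq_norm, one_mul]
    refine (ContinuousMap.norm_le _ (by positivity)).2 fun s => ?_
    rw [ContinuousMap.sub_apply, treeOperator_apply, treeOperator_apply, add_right_comm, pathIndex]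
    have hlt := lt_pathIndex s (n + k)
    refine (hclose _ (hpath s _) _ k (by omega)).1.le.trans ?_
    exact pow_le_pow_of_le_one (by norm_num) (by norm_num) (by omega)
  obtain ⟨V, hV⟩ := exists_tendsto_of_cauchySeq_dense (treeOperator c hcM)
    (norm_treeOperator_le c hcM) (denseRange_denseSeq Y) hcauchy
  refine ⟨C, x, V, hxC, fun m => ?_⟩
  have hsum : ∀ N, ∑ j ∈ Finset.Ico (m + 1) N, (1 / 8 : ℝ) ^ j ≤ (1 / 8) ^ m / 7 := by
    intro N
    refine (geom_sum_Ico_le_of_lt_one (by norm_num) (by norm_num)).trans (le_of_eq ?_)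
    rw [pow_succ]; ring
  -- from level `n₀` on, the value is determined up to the errors made below node `m`
  obtain ⟨n₀, hn₀⟩ : ∃ n₀, ∀ s, m < pathIndex s n₀ ∧ ‖c (pathIndex s n₀) (T (x m)) -
      haarSystem 𝕜 m s‖ ≤ ∑ j ∈ Finset.Ico (m + 1) (pathIndex s n₀), (1 / 8 : ℝ) ^ j := by
    rcases eq_or_ne m 0 with rfl | hm
    · exact ⟨0, fun s => by simp [pathIndex, hroot, haarSystem]⟩
    · set L := (dyadicNode m).length with hL
      have hmL : m < 2 ^ (L + 1) := (two_pow_length_dyadicNode_le hm).2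
      have hLm : 2 ^ L ≤ m := (two_pow_length_dyadicNode_le hm).1
      refine ⟨L + 1, fun s => ⟨hmL.trans_le (two_pow_le_pathIndex s _), ?_⟩⟩
      have hnonneg : ∀ a b, 0 ≤ ∑ j ∈ Finset.Ico a b, (1 / 8 : ℝ) ^ j := fun a b =>
        Finset.sum_nonneg fun _ _ => by positivity
      rw [haarSystem_apply 𝕜 hm, ← hL]
      -- Compare the branch with node `m` on its level. If it passes a smaller index, its next
      -- functional has index below `2m` and vanishes at `T (x m)`. If it passes `m`, the value is
      -- exactly `±1`. If it passes a larger index, that functional vanishes there, but its child is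
      -- chosen after `x m` and may be off by one error term.
      rcases lt_trichotomy (pathIndex s L) m with h | h | h
      · rw [if_neg h.ne, hzero m]
        · simpa using hnonneg _ _
        · rw [pathIndex, Nat.bit_val]
          have := Bool.toNat_le (s L)
          omega
      · rw [if_pos h, pathIndex, h, hself m hm, sub_self, norm_zero, ← h]
        exact hnonneg _ _
      · have h2 : pathIndex s L < 2 * m := by
          have := pathIndex_lt_two_pow s L
          rw [pow_succ] at this
          omega
        have h3 := (hclose _ (hpath s L) (s L) m h).2.le
        rw [hzero m _ h2] at h3
        rw [if_neg h.ne']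
        refine h3.trans (Finset.single_le_sum (f := fun j => (1 / 8 : ℝ) ^ j)
          (fun _ _ => by positivity) (Finset.mem_Ico.2 ⟨h, pathIndex_lt_succ s L⟩))
  have hstep : ∀ s, ∀ n ≥ n₀, m < pathIndex s n ∧ ‖c (pathIndex s n) (T (x m)) -
      haarSystem 𝕜 m s‖ ≤ ∑ j ∈ Finset.Ico (m + 1) (pathIndex s n), (1 / 8 : ℝ) ^ j := by
    intro s n hn
    induction n, hn using Nat.le_induction with
    | base => exact hn₀ s
    | succ n _ ih =>
      have hlt := pathIndex_lt_succ s n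
      refine ⟨ih.1.trans hlt, ?_⟩
      refine (norm_sub_le_norm_sub_add_norm_sub _ (c (pathIndex s n) (T (x m))) _).trans ?_
      refine (add_le_add (hclose _ (hpath s n) (s n) m ih.1).2.le ih.2).trans ?_
      rw [add_comm, ← Finset.sum_Ico_succ_top (by omega) fun j => (1 / 8 : ℝ) ^ j]
      exact Finset.sum_le_sum_of_subset_of_nonneg (Finset.Ico_subset_Ico_right hlt)
        fun _ _ _ => by positivity
  refine le_of_tendsto ((hV _).sub_const _).norm (Filter.eventually_atTop.2 ⟨n₀, fun n hn => ?_⟩)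
  exact (ContinuousMap.norm_le _ (by positivity)).2 fun s => (hstep s n hn).2.trans (hsum _)

end Tree

/-! ### Operators on `ℓ₁` -/

section EllOne

variable {𝕜 : Type*} [RCLike 𝕜] {Z : Type*} [NormedAddCommGroup Z] [NormedSpace 𝕜 Z]

theorem ellOne_hom_ext {S S' : lp (fun _ : ℕ => 𝕜) 1 →L[𝕜] Z}
    (h : ∀ m, S (lp.single 1 m (1 : 𝕜)) = S' (lp.single 1 m (1 : 𝕜))) : S = S' := by
  have key : ∀ m (a : 𝕜), (lp.single 1 m a : lp (fun _ : ℕ => 𝕜) 1) =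
      a • lp.single 1 m (1 : 𝕜) := fun m a => by
    rw [← lp.single_smul, smul_eq_mul, mul_one]
  ext f
  have hf := lp.hasSum_single (p := 1) ENNReal.one_ne_top f
  refine (S.hasSum hf).unique ?_
  convert S'.hasSum hf using 2 with m
  rw [key, map_smul, map_smul, h]

theorem exists_ellOne_hom [CompleteSpace Z] (z : ℕ → Z) {C : ℝ} (hz : ∀ m, ‖z m‖ ≤ C) :
    ∃ S : lp (fun _ : ℕ => 𝕜) 1 →L[𝕜] Z, ∀ m, S (lp.single 1 m (1 : 𝕜)) = z m := by
  have hC : 0 ≤ C := (norm_nonneg _).trans (hz 0)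
  have hnorm : ∀ f : lp (fun _ : ℕ => 𝕜) 1, HasSum (fun m => ‖f m‖) ‖f‖ := fun f => by
    simpa using lp.hasSum_norm (p := 1) (by simp) f
  have hle : ∀ (f : lp (fun _ : ℕ => 𝕜) 1) m, ‖f m • z m‖ ≤ C * ‖f m‖ := fun f m => by
    rw [norm_smul, mul_comm]
    exact mul_le_mul_of_nonneg_right (hz m) (norm_nonneg _)
  have hs : ∀ f : lp (fun _ : ℕ => 𝕜) 1, Summable fun m => f m • z m := fun f =>
    .of_norm_bounded ((hnorm f).summable.mul_left C) (hle f)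
  refine ⟨LinearMap.mkContinuous
    { toFun := fun f => ∑' m, f m • z m
      map_add' := fun f f' => by
        rw [← (hs f).tsum_add (hs f')]
        exact tsum_congr fun m => by rw [lp.coeFn_add, Pi.add_apply, add_smul]
      map_smul' := fun r f => by
        rw [RingHom.id_apply, ← (hs f).tsum_const_smul r]
        exact tsum_congr fun m => by rw [lp.coeFn_smul, Pi.smul_apply, smul_assoc] } C fun f =>
      tsum_of_norm_bounded ((hnorm f).mul_left C) (hle f), fun m => ?_⟩
  change ∑' k, (lp.single 1 m (1 : 𝕜) : lp (fun _ : ℕ => 𝕜) 1) k • z k = z m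
  rw [tsum_eq_single m fun k hk => by rw [lp.single_apply_ne _ _ _ hk, zero_smul],
    lp.single_apply_self, one_smul]

end EllOne

/-! ### The Haar operator -/

section HaarOperator

variable {𝕜 : Type*} [RCLike 𝕜]

theorem existsUnique_mapsUnitVectorsToHaar :
    ∃! J : lp (fun _ : ℕ => 𝕜) 1 →L[𝕜] C(ℕ → Bool, 𝕜), MapsUnitVectorsToHaar J := by
  obtain ⟨J, hJ⟩ := exists_ellOne_hom (𝕜 := 𝕜) (haarSystem 𝕜) (norm_haarSystem_le 𝕜)
  exact ⟨J, hJ, fun J' hJ' => ellOne_hom_ext fun m => (hJ' m).trans (hJ m).symm⟩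

/-- Functions close to the Haar functions are carried to them by a bounded operator. -/
theorem exists_map_eq_haarSystem (f : ℕ → C(ℕ → Bool, 𝕜))
    (hf : ∀ m, ‖f m - haarSystem 𝕜 m‖ ≤ (1 / 8) ^ m / 7) :
    ∃ A : C(ℕ → Bool, 𝕜) →L[𝕜] C(ℕ → Bool, 𝕜), ∀ m, A (f m) = haarSystem 𝕜 m := by
  obtain ⟨g, hgn, hg1, hg0⟩ := exists_haarSystem_biorthogonal 𝕜
  -- By biorthogonality `1 - ∑ P m` sends each `h_m` to `f m`. It is invertible by the Neumann
  -- series, since `∑ ‖P m‖ ≤ ∑ 4 ^ (-m) / 7 = 4 / 21 < 1`.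
  let P : ℕ → C(ℕ → Bool, 𝕜) →L[𝕜] C(ℕ → Bool, 𝕜) := fun m =>
    (g m).smulRight (haarSystem 𝕜 m - f m)
  have hP : ∀ m, ‖P m‖ ≤ (1 / 4) ^ m * (1 / 7) := by
    intro m
    rw [ContinuousLinearMap.norm_smulRight_apply, norm_sub_rev]
    refine (mul_le_mul (hgn m) (hf m) (norm_nonneg _) (by positivity)).trans (le_of_eq ?_)
    rw [mul_div_assoc', ← mul_pow]
    norm_num
    ring
  have hgeo := (hasSum_geometric_of_lt_one (r := (1 / 4 : ℝ)) (by norm_num)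
    (by norm_num)).mul_right (1 / 7)
  have hPs : Summable P := .of_norm_bounded hgeo.summable hP
  have hlt : ‖∑' m, P m‖ < 1 := (tsum_of_norm_bounded hgeo hP).trans_lt (by norm_num)
  have hPk : ∀ k, (∑' m, P m) (haarSystem 𝕜 k) = haarSystem 𝕜 k - f k := by
    intro k
    rw [← ContinuousLinearMap.apply_apply (𝕜 := 𝕜) (haarSystem 𝕜 k) (∑' m, P m),
      ContinuousLinearMap.map_tsum _ hPs, tsum_eq_single k]
    · simp [P, hg1]
    · intro m hm
      simp [P, hg0 k m hm.symm]
  let B : (C(ℕ → Bool, 𝕜) →L[𝕜] C(ℕ → Bool, 𝕜))ˣ := Units.oneSub (∑' m, P m) hlt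
  refine ⟨(B⁻¹ : _ˣ).val, fun m => ?_⟩
  have hB : (B : C(ℕ → Bool, 𝕜) →L[𝕜] C(ℕ → Bool, 𝕜)) (haarSystem 𝕜 m) = f m := by
    rw [Units.val_oneSub, sub_apply, hPk]
    simp
  rw [← hB]
  exact DFunLike.congr_fun B.inv_mul (haarSystem 𝕜 m)

theorem MapsUnitVectorsToHaar.operatorFactorsThrough
    {J : lp (fun _ : ℕ => 𝕜) 1 →L[𝕜] C(ℕ → Bool, 𝕜)} (hJ : MapsUnitVectorsToHaar J)
    {X : Type*} [NormedAddCommGroup X] [NormedSpace 𝕜 X] [CompleteSpace X]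
    {Y : Type*} [NormedAddCommGroup Y] [NormedSpace 𝕜 Y] [CompleteSpace Y] [SeparableSpace Y]
    (T : X →L[𝕜] Y) (hT : ¬ IsSeparable (Set.range (banachAdjoint T))) :
    OperatorFactorsThrough J T := by
  obtain ⟨C, x, V, hx, hV⟩ := exists_approx_haar_factorization T hT
  obtain ⟨A, hA⟩ := exists_map_eq_haarSystem _ hV
  obtain ⟨U, hU⟩ := exists_ellOne_hom (𝕜 := 𝕜) x hx
  exact ⟨U, A ∘L V, ellOne_hom_ext fun m => by simp [hU, hA, hJ m]⟩

/-- At the node where the two sequences branch, the Haar function takes opposite signs. -/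
theorem exists_haarSystem_apply_eq {s s' : ℕ → Bool} (h : s ≠ s') :
    ∃ m, 1 ≤ ‖haarSystem 𝕜 m s - haarSystem 𝕜 m s'‖ := by
  classical
  have hex : ∃ n, s n ≠ s' n := Function.ne_iff.1 h
  set n := Nat.find hex with hn
  have hne : s n ≠ s' n := Nat.find_spec hex
  have hlt : ∀ k < n, s k = s' k := fun k hk => not_not.1 (Nat.find_min hex hk)
  have hm : pathIndex s n ≠ 0 := (Nat.zero_lt_of_lt (lt_pathIndex s n)).ne'
  have hlen : (dyadicNode (pathIndex s n)).length = n := by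
    obtain ⟨h1, h2⟩ := two_pow_length_dyadicNode_le hm
    have h3 := two_pow_le_pathIndex s n
    have h4 := pathIndex_lt_two_pow s n
    have h5 := (Nat.pow_lt_pow_iff_right one_lt_two).1 (h1.trans_lt h4)
    have h6 := (Nat.pow_lt_pow_iff_right one_lt_two).1 (h3.trans_lt h2)
    omega
  refine ⟨pathIndex s n, ?_⟩
  rw [haarSystem_apply 𝕜 hm, haarSystem_apply 𝕜 hm, hlen, if_pos rfl,
    if_pos (pathIndex_congr hlt).symm]
  cases h1 : s n <;> cases h2 : s' n
  · simp [h1, h2] at hne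
  · norm_num
  · norm_num [RCLike.norm_ofNat]
  · simp [h1, h2] at hne

/-- Testing on unit vectors shows that the functionals `J* δ_s` are pairwise at distance at least
`1`. Approximating them within `1 / 2` from a countable set would inject `{0,1}^ω` into it, against
Cantor's theorem. -/
theorem MapsUnitVectorsToHaar.not_isSeparable_range_banachAdjoint
    {J : lp (fun _ : ℕ => 𝕜) 1 →L[𝕜] C(ℕ → Bool, 𝕜)} (hJ : MapsUnitVectorsToHaar J) :
    ¬ IsSeparable (Set.range (banachAdjoint J)) := by
  intro hsep
  let φ : (ℕ → Bool) → StrongDual 𝕜 (lp (fun _ : ℕ => 𝕜) 1) := fun s =>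
    banachAdjoint J (ContinuousMap.evalCLM 𝕜 s)
  have hφ : ∀ s s', s ≠ s' → 1 ≤ dist (φ s) (φ s') := by
    intro s s' hss
    obtain ⟨m, hm⟩ := exists_haarSystem_apply_eq (𝕜 := 𝕜) hss
    have h1 := (φ s - φ s').le_opNorm (lp.single 1 m (1 : 𝕜))
    rw [lp.norm_single one_pos, norm_one, mul_one] at h1
    rw [dist_eq_norm]
    refine le_trans ?_ h1
    change 1 ≤ ‖J (lp.single 1 m (1 : 𝕜)) s - J (lp.single 1 m (1 : 𝕜)) s'‖
    rwa [hJ m]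
  obtain ⟨D, hD, hsub⟩ := hsep
  have hnear : ∀ s, ∃ d ∈ D, dist (φ s) d < 1 / 2 := fun s =>
    Metric.mem_closure_iff.1 (hsub ⟨_, rfl⟩) _ (by norm_num)
  choose d hdD hd using hnear
  have hinj : Function.Injective fun s => (⟨d s, hdD s⟩ : D) := by
    intro s s' hss
    by_contra hne
    have h1 := hφ s s' hne
    have h2 := dist_triangle_right (φ s) (φ s') (d s)
    have h3 := hd s'
    rw [← (Subtype.mk.inj hss : d s = d s')] at h3
    linarith [hd s]
  have := hD.to_subtype
  have hc : Countable (ℕ → Bool) := hinj.countable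
  have hle := Cardinal.mk_le_aleph0 (α := ℕ → Bool)
  rw [← Cardinal.power_def, Cardinal.mk_bool, Cardinal.mk_nat] at hle
  exact (Cardinal.cantor _).not_ge hle

end HaarOperator

theorem mainTheorem5 {𝕜 : Type w} [RCLike 𝕜] :
    (∃! J : lp (fun _ : ℕ => 𝕜) 1 →L[𝕜] C(ℕ → Bool, 𝕜), MapsUnitVectorsToHaar J) ∧
    ∀ J : lp (fun _ : ℕ => 𝕜) 1 →L[𝕜] C(ℕ → Bool, 𝕜), MapsUnitVectorsToHaar J →
      (∀ (X : Type u) [NormedAddCommGroup X] [NormedSpace 𝕜 X] [CompleteSpace X]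
        (Y : Type v) [NormedAddCommGroup Y] [NormedSpace 𝕜 Y] [CompleteSpace Y]
        [TopologicalSpace.SeparableSpace Y] (T : X →L[𝕜] Y),
        ¬ TopologicalSpace.IsSeparable (Set.range (banachAdjoint T)) →
          OperatorFactorsThrough J T) ∧
      IsUniversalSepCodomainNonsepAdjoint.{u, v} J := by
  refine ⟨existsUnique_mapsUnitVectorsToHaar, fun J hJ => ⟨?_, ?_, ?_⟩⟩
  · intro X _ _ _ Y _ _ _ _ T hT
    exact hJ.operatorFactorsThrough T hT
  · exact ⟨inferInstance, hJ.not_isSeparable_range_banachAdjoint⟩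
  · rintro X _ _ _ Y _ _ _ T ⟨_, hT⟩
    exact hJ.operatorFactorsThrough T hT
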